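/- **Setting.** A gMDP $\mathbf M=(\mathbb X,\mathbb U,\mathbb Y,x_0,\mathbf t,h)$ consists of standard Borel (Polish) state and input spaces $\mathbb X,\mathbb U$, a metric output space $\mathbb Y$ with metric $\mathbf d$, an initial state $x_0$, a Borel stochastic kernel $\mathbf t(dx'\mid x,u)$ and a measurable output map $h:\mathbb X\to\mathbb Y$. For a probability measure $p$ on $\mathbb U$ put $\mathbf t(\cdot\mid x,p)=\int\mathbf t(\cdot\mid x,u)\,p(du)$. A control strategy $\mathbf C$ for $\mathbf M$ has a standard Borel memory space, an initial memory state $c_0$, a universally measurable kernel $\mathbf t_{\mathbf C}(dc'\mid c,x)$ and a universally measurable map $h_{\mathbf C}$ from memory states to probability measures on $\mathbb U$; the execution of $\mathbf C\times\mathbf M$ starts in $(x_0,c_0)$ and draws $c_{t+1}\sim\mathbf t_{\mathbf C}(\cdot\mid c_t,x_t)$, $u_t\sim h_{\mathbf C}(c_{t+1})$, $x_{t+1}\sim\mathbf t(\cdot\mid x_t,u_t)$. Let $AP$ be a finite set of atomic propositions, $\mathsf L:\mathbb Y\to 2^{AP}$ a measurable labelling, $\psi$ an scLTL formula over $AP$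 (built from $p$, $\neg p$, $\wedge$, $\vee$, $\bigcirc$, $\mathsf U$), and $\mathcal A_\psi=(Q,q_0,2^{AP},F,\tau)$ a DFA with finitely many locations that accepts an infinite word (i.e. reaches $F$ on some finite prefix of it) if and only if the word satisfies $\psi$. $\mathbf C\times\mathbf M$ satisfies $\psi$ with probability $\mathbb P_{\mathbf C\times\mathbf M}\big((\mathsf L(h(x_t)))_{t\ge0}\models\psi\big)$. For gMDPs $\widehat{\mathbf M}=(\hat{\mathbb X},\hat{\mathbb U},\mathbb Y,\hat x_0,\hat{\mathbf t},\hat h)$ and $\mathbf M=(\mathbb X,\mathbb U,\mathbb Y,x_0,\mathbf t,h)$, $\widehat{\mathbf M}\preceq^\delta_\epsilon\mathbf M$ means that there are a universally measurable interface $\mathcal U_v:\hat{\mathbb U}\times\hat{\mathbb X}\times\mathbb X\to\mathcal P(\mathbb U)$, a measurable relation $\mathcal R\subseteq\hat{\mathbb X}\times\mathbb X$ with $(\hat x_0,x_0)\in\mathcal R$, and a Borel stochastic kernel $\mathbb W(\cdot\mid\hat u,\hat x,x)$ on $\hat{\mathbb X}\times\mathbb X$ such that for all $(\hat x,x)\in\mathcal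 R$: $\mathbf d(\hat h(\hat x),h(x))\le\epsilon$, and for all $\hat u\in\hat{\mathbb U}$ the measure $\mathbb W(\cdot\mid\hat u,\hat x,x)$ has marginals $\hat{\mathbf t}(\cdot\mid\hat x,\hat u)$ and $\mathbf t(\cdot\mid x,\mathcal U_v(\hat u,\hat x,x))$ and gives $\mathcal R$ mass at least $1-\delta$. Let $\bar\tau(q,\hat x)=\{\tau(q,\mathsf L(y)) : y\in\mathbb Y,\ \mathbf d(y,\hat h(\hat x))\le\epsilon\}$. For a universally measurable $\mu:\hat{\mathbb X}\times Q\to\mathcal P(\hat{\mathbb U})$ and $V:\hat{\mathbb X}\times Q\to[0,1]$ put $$\mathbf T^\mu_{\epsilon,\delta}(V)(\hat x,q)=\min\Big(1,\max\Big(0,\int\min_{q'\in\bar\tau(q,\hat x')}\max\{\mathbf 1_F(q'),V(\hat x',q')\}\,\hat{\mathbf t}(d\hat x'\mid\hat x,\mu(\hat x,q))-\delta\Big)\Big),$$ $\mathbf T^*_{\epsilon,\delta}(V)=\sup_\mu\mathbf T^\mu_{\epsilon,\delta}(V)$ pointwise, $V^*_\infty=\lim_{l\to\infty}(\mathbf T^*_{\epsilon,\delta})^l(0)$,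 and $$\mathcal S^*_{\epsilon,\delta}=\min_{\bar q_0\in\bar\tau(q_0,\hat x_0)}\max\{\mathbf 1_F(\bar q_0),V^*_\infty(\hat x_0,\bar q_0)\}.$$ **Corollary.** Let $\epsilon\ge0$ and $\delta>0$, let $\widehat{\mathbf M}$, $\mathsf L$, $\psi$, $\mathcal A_\psi$ be as above, and suppose that for every letter $\alpha\in 2^{AP}$ the set $\{\hat x:\alpha\in\mathsf L(\{y:\mathbf d(y,\hat h(\hat x))\le\epsilon\})\}$ is measurable. Let $\mu^*\in\arg\sup_\mu\mathbf T^\mu_{\epsilon,\delta}(V^*_\infty)$, i.e. $\mathbf T^{\mu^*}_{\epsilon,\delta}(V^*_\infty)=\mathbf T^*_{\epsilon,\delta}(V^*_\infty)$ at every point. Then for every gMDP $\mathbf M$ with $\widehat{\mathbf M}\preceq^\delta_\epsilon\mathbf M$, witnessed by any $(\mathcal U_v,\mathcal R,\mathbb W)$, the control strategy $\mathbf C$ for $\mathbf M$ that refines $\mu^*$ through this witness satisfies $$\mathbb P_{\mathbf C\times\mathbf M}(\psi)\ \ge\ \mathcal S^*_{\epsilon,\delta}.$$ Here $\mathbf C$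 stores $(\hat x_{t-1},x_{t-1},q_{t-1},\hat u_{t-1})$. On observing $x_t$ it draws $\hat x_t$ from the conditional law under $\mathbb W(d\hat x'\,dx'\mid\hat u_{t-1},\hat x_{t-1},x_{t-1})$ of $\hat x'$ given $x'=x_t$ (at $t=0$ it takes the initial abstract state), sets $q_t=\tau(q_{t-1},\mathsf L(h(x_t)))$ (at $t=0$ with the initial location of $\mathcal A_\psi$ in place of $q_{t-1}$), draws $\hat u_t\sim\mu^*(\hat x_t,q_t)$, and outputs $\mathcal U_v(\hat u_t,\hat x_t,x_t)$. -/

import Mathlib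

set_option linter.unusedSectionVars false

open MeasureTheory ProbabilityTheory Filter Topology
open scoped ENNReal

/-! ### Universal measurability -/

/-- `Univ X` is a copy of the measurable space `X` which carries the σ-algebra of universally
measurable sets, i.e. of the sets that belong to the completion of every finite measure on `X`. -/
def Univ (X : Type*) : Type _ := X

instance Univ.instMeasurableSpace (X : Type*) [MeasurableSpace X] : MeasurableSpace (Univ X) where
  MeasurableSet' s := ∀ (ν : Measure X) [IsFiniteMeasure ν], NullMeasurableSet (α := X) s ν
  measurableSet_empty _ _ := nullMeasurableSet_empty
  measurableSet_compl _ hs ν _ := (hs ν).compl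
  measurableSet_iUnion _ hf ν _ := NullMeasurableSet.iUnion fun i => hf i ν

/-- The identity map, regarded as a map from `Univ X` to `X`. -/
def Univ.out {X : Type*} (x : Univ X) : X := x

/-- The identity map, regarded as a map from `X` to `Univ X`. -/
def Univ.of {X : Type*} (x : X) : Univ X := x

theorem Univ.measurable_out {X : Type*} [MeasurableSpace X] :
    Measurable (Univ.out : Univ X → X) :=
  fun _ hs _ _ => hs.nullMeasurableSet

/-- A map `X → Y`, regarded as a map `Univ X → Univ Y`. -/
def Univ.map {X Y : Type*} (f : X → Y) : Univ X → Univ Y := f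

theorem Univ.measurable_map {X Y : Type*} [MeasurableSpace X] [MeasurableSpace Y] {f : X → Y}
    (hf : Measurable f) : Measurable (Univ.map f) := by
  intro s hs ν _
  exact (hs (ν.map f)).preimage ⟨hf, Measure.AbsolutelyContinuous.rfl⟩

/-- The extension of a finite measure on `X` to the universally measurable sets. -/
noncomputable def extendMeasure {X : Type*} [MeasurableSpace X] (ν : Measure X)
    [IsFiniteMeasure ν] : Measure (Univ X) :=
  Measure.ofMeasurable (fun s _ => ν s) measure_empty fun _ hf hd =>
    measure_iUnion₀ (fun _ _ hij => (hd hij).aedisjoint) fun i => hf i ν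

theorem extendMeasure_apply {X : Type*} [MeasurableSpace X] (ν : Measure X) [IsFiniteMeasure ν]
    {s : Set (Univ X)} (hs : MeasurableSet s) :
    extendMeasure ν s = ν (show Set X from s) :=
  Measure.ofMeasurable_apply s hs

instance {X : Type*} [MeasurableSpace X] (ν : Measure X) [IsFiniteMeasure ν] :
    IsFiniteMeasure (extendMeasure ν) :=
  ⟨by rw [extendMeasure_apply ν MeasurableSet.univ]; exact measure_lt_top ν Set.univ⟩

/-- A universally measurable Markov kernel from `X` to `Y`, where each of its measures is extended
to the universally measurable subsets of `Y`. -/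
noncomputable def extendKernel {X Y : Type*} [MeasurableSpace X] [MeasurableSpace Y]
    (κ : Kernel (Univ X) Y) [IsMarkovKernel κ] : Kernel (Univ X) (Univ Y) where
  toFun x := extendMeasure (κ x)
  measurable' := by
    refine Measure.measurable_of_measurable_coe _ fun s hs => ?_
    simp_rw [extendMeasure_apply _ hs]
    intro B hB ν _
    obtain ⟨t, ht, hst⟩ := hs ((extendMeasure ν).bind κ)
    have h1 : ∀ᵐ x ∂(extendMeasure ν), ∀ᵐ y ∂(κ x), s y = t y :=
      Measure.ae_ae_of_ae_bind κ.aemeasurable hst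
    have h2 : ∀ᵐ x ∂(extendMeasure ν), κ x (show Set Y from s) = κ x t := by
      filter_upwards [h1] with x hx using measure_congr hx
    have h3 : ∀ᵐ x ∂ν, κ (Univ.of x) (show Set Y from s) = κ (Univ.of x) t := by
      obtain ⟨N, hN, hNm, hN0⟩ := exists_measurable_superset_of_null (ae_iff.1 h2)
      rw [extendMeasure_apply ν hNm] at hN0
      exact ae_iff.2 (measure_mono_null hN hN0)
    have h4 : NullMeasurableSet (α := X) ((fun x : Univ X => κ x t) ⁻¹' B) ν :=
      (κ.measurable_coe ht) hB ν
    refine h4.congr ?_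
    filter_upwards [h3] with x hx
    exact congrArg B hx.symm

instance {X Y : Type*} [MeasurableSpace X] [MeasurableSpace Y]
    (κ : Kernel (Univ X) Y) [IsMarkovKernel κ] : IsMarkovKernel (extendKernel κ) :=
  ⟨fun x => ⟨by
    change extendMeasure (κ x) Set.univ = 1
    rw [extendMeasure_apply _ MeasurableSet.univ]
    exact measure_univ (μ := κ x)⟩⟩

/-! ### General Markov decision processes, policies and control strategies -/

/-- A general Markov decision process with state space `X`, input space `U` and output space `Y`:
initial state, Borel stochastic kernel, measurable output map. -/
structure GMDP (X U Y : Type*) [MeasurableSpace X] [StandardBorelSpace X] [MeasurableSpace U]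
    [StandardBorelSpace U] [MeasurableSpace Y] where
  init : X
  trans : Kernel (X × U) X
  markov : IsMarkovKernel trans
  out : X → Y
  measurable_out : Measurable out

attribute [instance] GMDP.markov

/-- `∫ t(· | x, u) p(du)`: the law of the next state from `x` when the input has law `p`. -/
noncomputable def mixedTrans {X U : Type*} [MeasurableSpace X] [MeasurableSpace U]
    (t : Kernel (X × U) X) (x : X) (p : ProbabilityMeasure U) : Measure X :=
  (p : Measure U).bind fun u => t (x, u)

/-- A universally measurable map from `Z` to the probability measures on `U`. A stationary Markov
policy consists in applying the same such map at all times. -/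
structure Policy (Z U : Type*) [MeasurableSpace Z] [MeasurableSpace U] where
  toFun : Z → ProbabilityMeasure U
  measurable : Measurable fun z : Univ Z => toFun z.out

/-- A policy as a (universally measurable) Markov kernel. -/
noncomputable def Policy.kernel {Z U : Type*} [MeasurableSpace Z] [MeasurableSpace U]
    (μ : Policy Z U) : Kernel (Univ Z) U where
  toFun z := (μ.toFun z.out : Measure U)
  measurable' := measurable_subtype_coe.comp μ.measurable

instance {Z U : Type*} [MeasurableSpace Z] [MeasurableSpace U] (μ : Policy Z U) :
    IsMarkovKernel μ.kernel :=
  ⟨fun z => (μ.toFun z.out).2⟩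

/-- A control strategy with memory space `C` for a gMDP with state space `X` and input space `U`:
initial memory state, universally measurable transition kernel `t_C(dc' | c, x)`, universally
measurable output map `h_C : C → 𝒫(U)`. -/
structure ControlStrategy (C X U : Type*) [MeasurableSpace C] [StandardBorelSpace C]
    [MeasurableSpace X] [MeasurableSpace U] where
  init : C
  trans : Kernel (Univ (C × X)) C
  markov : IsMarkovKernel trans
  out : Policy C U

attribute [instance] ControlStrategy.markov

theorem measurable_stepMap {X C : Type*} [MeasurableSpace X] [MeasurableSpace C] :
    Measurable (fun p : Univ C × X => (p.2, p.1.out)) :=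
  measurable_snd.prodMk (Univ.measurable_out.comp measurable_fst)

section Execution

variable {X U Y C : Type*} [MeasurableSpace X] [StandardBorelSpace X] [MeasurableSpace U]
  [StandardBorelSpace U] [MeasurableSpace Y] [MeasurableSpace C] [StandardBorelSpace C]

/-- The law of the next input and state of the gMDP, given its state `x` and the updated memory
state `c'`: the input is `u ∼ h_C(c')` and the next state is `x' ∼ t(· | x, u)`. -/
noncomputable def inputStateKernel (M : GMDP X U Y) (S : ControlStrategy C X U) :
    Kernel (X × Univ C) X :=
  ((S.out.kernel.comap Prod.snd measurable_snd) ⊗ₖ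
    (M.trans.comap (fun p : (X × Univ C) × U => (p.1.1, p.2)) (by fun_prop))).snd

instance (M : GMDP X U Y) (S : ControlStrategy C X U) :
    IsMarkovKernel (inputStateKernel M S) := by
  unfold inputStateKernel; infer_instance

/-- One step of the controlled gMDP: from `(x, c)`, first the memory is updated by
`c' ∼ t_C(· | c, x)`, then `u ∼ h_C(c')` and `x' ∼ t(· | x, u)`; the next pair is `(x', c')`. -/
noncomputable def stepKernel (M : GMDP X U Y) (S : ControlStrategy C X U) :
    Kernel (Univ (X × C)) (X × C) :=
  ((extendKernel (S.trans.comap (Univ.map Prod.swap) (Univ.measurable_map measurable_swap))) ⊗ₖ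
    ((inputStateKernel M S).comap
      (fun p : Univ (X × C) × Univ C => (p.1.out.1, p.2))
      ((measurable_fst.comp (Univ.measurable_out.comp measurable_fst)).prodMk
        measurable_snd))).map (fun p : Univ C × X => (p.2, p.1.out))

instance (M : GMDP X U Y) (S : ControlStrategy C X U) : IsMarkovKernel (stepKernel M S) := by
  unfold stepKernel; exact Kernel.IsMarkovKernel.map _ measurable_stepMap

/-- The law of the execution `(x_t, c_t)_{t ∈ ℕ}` of the controlled gMDP. It is obtained from the
Ionescu-Tulcea theorem over the universal σ-algebras, and then restricted to the product Borel
σ-algebra. -/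
noncomputable def execLaw (M : GMDP X U Y) (S : ControlStrategy C X U) :
    Measure (ℕ → X × C) :=
  (Kernel.traj (X := fun _ => Univ (X × C))
    (fun n => (extendKernel (stepKernel M S)).comap
      (fun p : (Π _ : Finset.Iic n, Univ (X × C)) => p ⟨n, Finset.mem_Iic.2 le_rfl⟩)
      (measurable_pi_apply _)) 0 (fun _ => Univ.of (M.init, S.init))).map
    (fun z t => (z t).out)

end Execution

/-! ### Syntactically co-safe LTL and automata -/

/-- scLTL formulas over the atomic propositions `AP`. -/
inductive ScLTL (AP : Type*) where
  | atom (p : AP)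
  | natom (p : AP)
  | and (ψ₁ ψ₂ : ScLTL AP)
  | or (ψ₁ ψ₂ : ScLTL AP)
  | next (ψ : ScLTL AP)
  | until (ψ₁ ψ₂ : ScLTL AP)

/-- `ψ.Sat ω t`: the suffix `ω_t, ω_{t+1}, …` of the word `ω` satisfies `ψ`. -/
def ScLTL.Sat {AP : Type*} : ScLTL AP → (ℕ → Set AP) → ℕ → Prop
  | .atom p, ω, t => p ∈ ω t
  | .natom p, ω, t => p ∉ ω t
  | .and ψ₁ ψ₂, ω, t => ψ₁.Sat ω t ∧ ψ₂.Sat ω t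
  | .or ψ₁ ψ₂, ω, t => ψ₁.Sat ω t ∨ ψ₂.Sat ω t
  | .next ψ, ω, t => ψ.Sat ω (t + 1)
  | .until ψ₁ ψ₂, ω, t => ∃ i, ψ₂.Sat ω (t + i) ∧ ∀ j < i, ψ₁.Sat ω (t + j)

/-- The automaton accepts the infinite word `ω`: its run on some finite prefix ends in an
accepting location. -/
def AcceptsWord {α Q : Type*} (A : DFA α Q) (ω : ℕ → α) : Prop :=
  ∃ n : ℕ, A.eval ((List.range n).map ω) ∈ A.accept

/-! ### Approximate simulation relations -/

/-- `W` is a lifting which shows that `(Δ, Θ)` belongs to the `δ`-lifting of the relation `R`. -/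
structure IsLifting {Xh X : Type*} [MeasurableSpace Xh] [MeasurableSpace X] (R : Set (Xh × X))
    (δ : ℝ) (Δ : Measure Xh) (Θ : Measure X) (W : Measure (Xh × X)) : Prop where
  left : ∀ B : Set Xh, MeasurableSet B → W (B ×ˢ Set.univ) = Δ B
  right : ∀ B : Set X, MeasurableSet B → W (Set.univ ×ˢ B) = Θ B
  mass : 1 - δ ≤ W.real R

section Simulation

variable {Xh Uh X U Y : Type*} [MeasurableSpace Xh] [StandardBorelSpace Xh]
  [MeasurableSpace Uh] [StandardBorelSpace Uh] [MeasurableSpace X] [StandardBorelSpace X]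
  [MeasurableSpace U] [StandardBorelSpace U] [MetricSpace Y] [MeasurableSpace Y] [BorelSpace Y]

/-- An `(ε, δ)`-stochastic simulation relation of the abstract gMDP `Mh` by the concrete gMDP `M`:
interface function `(û, x̂, x) ↦ 𝒰(û, x̂, x) ∈ 𝒫(U)`, relation and lifted kernel. The gMDP `Mh` is `(ε, δ)`-stochastically simulated
by `M` if there is one. -/
structure Simulation (Mh : GMDP Xh Uh Y) (M : GMDP X U Y) (ε δ : ℝ) where
  interface : Policy (Uh × Xh × X) U
  R : Set (Xh × X)
  measurableSet_R : MeasurableSet R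
  W : Kernel (Uh × Xh × X) (Xh × X)
  markov : IsMarkovKernel W
  init_mem : (Mh.init, M.init) ∈ R
  dist_le : ∀ xh x, (xh, x) ∈ R → dist (Mh.out xh) (M.out x) ≤ ε
  lifting : ∀ xh x, (xh, x) ∈ R → ∀ uh : Uh,
    IsLifting R δ (Mh.trans (xh, uh))
      (mixedTrans M.trans x (interface.toFun (uh, xh, x))) (W (uh, xh, x))

attribute [instance] Simulation.markov

end Simulation

/-! ### Robust dynamic programming -/

section Robust

variable {Xh Uh Y AP Q : Type*} [MeasurableSpace Xh] [StandardBorelSpace Xh]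
  [MeasurableSpace Uh] [StandardBorelSpace Uh] [MetricSpace Y] [MeasurableSpace Y]
  [BorelSpace Y] [MeasurableSpace Q]

/-- The set `τ̄(q, x̂)` of all `τ(q, L(y))` with `d(y, ĥ(x̂)) ≤ ε`. -/
def nextLocations (Mh : GMDP Xh Uh Y) (L : Y → Set AP) (A : DFA (Set AP) Q) (ε : ℝ) (q : Q)
    (xh : Xh) : Set Q :=
  {q' | ∃ y : Y, dist y (Mh.out xh) ≤ ε ∧ A.step q (L y) = q'}

/-- `min_{q' ∈ τ̄(q, x̂)} max {1_F(q'), V(x̂, q')}`. -/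
noncomputable def worstValue (Mh : GMDP Xh Uh Y) (L : Y → Set AP) (A : DFA (Set AP) Q) (ε : ℝ)
    (V : Xh × Q → ℝ≥0∞) (q : Q) (xh : Xh) : ℝ≥0∞ :=
  ⨅ q' ∈ nextLocations Mh L A ε q xh, max (A.accept.indicator 1 q') (V (xh, q'))

/-- The `(ε, δ)`-robust operator of a policy. Values are in `[0, ∞]`, where the subtraction is
truncated at `0`; the minimum with `1` completes the truncation to `[0, 1]`. -/
noncomputable def robustOp (Mh : GMDP Xh Uh Y) (L : Y → Set AP) (A : DFA (Set AP) Q) (ε δ : ℝ)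
    (μ : Policy (Xh × Q) Uh) (V : Xh × Q → ℝ≥0∞) : Xh × Q → ℝ≥0∞ :=
  fun z => min 1
    ((∫⁻ xh', worstValue Mh L A ε V z.2 xh' ∂(mixedTrans Mh.trans z.1 (μ.toFun z))) -
      ENNReal.ofReal δ)

/-- The optimal `(ε, δ)`-robust operator: the pointwise supremum over all policies. -/
noncomputable def optRobustOp (Mh : GMDP Xh Uh Y) (L : Y → Set AP) (A : DFA (Set AP) Q)
    (ε δ : ℝ) (V : Xh × Q → ℝ≥0∞) : Xh × Q → ℝ≥0∞ :=
  fun z => ⨆ μ : Policy (Xh × Q) Uh, robustOp Mh L A ε δ μ V z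

/-- The limit of the increasing sequence of iterates of the optimal robust operator, started at
`0` (see `tendsto_optValue`). -/
noncomputable def optValue (Mh : GMDP Xh Uh Y) (L : Y → Set AP) (A : DFA (Set AP) Q)
    (ε δ : ℝ) : Xh × Q → ℝ≥0∞ :=
  fun z => ⨆ l : ℕ, (optRobustOp Mh L A ε δ)^[l] 0 z

theorem monotone_optRobustOp (Mh : GMDP Xh Uh Y) (L : Y → Set AP) (A : DFA (Set AP) Q)
    (ε δ : ℝ) : Monotone (optRobustOp Mh L A ε δ) := by
  intro V V' h z
  refine iSup_mono fun μ => min_le_min le_rfl (tsub_le_tsub_right (lintegral_mono fun x => ?_) _)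
  exact iInf₂_mono fun q' _ => max_le_max le_rfl (h (x, q'))

theorem tendsto_optValue (Mh : GMDP Xh Uh Y) (L : Y → Set AP) (A : DFA (Set AP) Q)
    (ε δ : ℝ) (z : Xh × Q) :
    Tendsto (fun l : ℕ => (optRobustOp Mh L A ε δ)^[l] 0 z) atTop
      (𝓝 (optValue Mh L A ε δ z)) := by
  refine tendsto_atTop_iSup fun l m hlm => ?_
  exact (monotone_optRobustOp Mh L A ε δ).monotone_iterate_of_le_map
    (fun _ => bot_le) hlm z

/-- The optimal `(ε, δ)`-robust satisfaction probability
`min_{q̄₀ ∈ τ̄(q₀, x̂₀)} max {1_F(q̄₀), V*_∞(x̂₀, q̄₀)}`. -/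
noncomputable def optRobustSat (Mh : GMDP Xh Uh Y) (L : Y → Set AP) (A : DFA (Set AP) Q)
    (ε δ : ℝ) : ℝ≥0∞ :=
  worstValue Mh L A ε (optValue Mh L A ε δ) A.start Mh.init

/-- The policy `μ` is an optimal `(ε, δ)`-robust policy: it attains the supremum that defines
`T*(V*_∞)`, at every point. -/
def IsOptimalRobustPolicy (Mh : GMDP Xh Uh Y) (L : Y → Set AP) (A : DFA (Set AP) Q)
    (ε δ : ℝ) (μ : Policy (Xh × Q) Uh) : Prop :=
  robustOp Mh L A ε δ μ (optValue Mh L A ε δ) = optRobustOp Mh L A ε δ (optValue Mh L A ε δ)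

end Robust

/-! ### Refinement of a policy on the abstract model to a strategy for the concrete model -/

section Refinement

variable {Xh Uh X U Y AP Q : Type*} [MeasurableSpace Xh] [StandardBorelSpace Xh]
  [MeasurableSpace Uh] [StandardBorelSpace Uh] [MeasurableSpace X] [StandardBorelSpace X]
  [MeasurableSpace U] [StandardBorelSpace U] [MetricSpace Y] [MeasurableSpace Y] [BorelSpace Y]
  [Finite AP] [Finite Q] [MeasurableSpace Q] [DiscreteMeasurableSpace Q]

/-- The memory of the refined strategy: a flag which is `false` only initially, the abstract and
the concrete state, the automaton location and the abstract input of the last step. -/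
abbrev Memory (Xh X Q Uh : Type*) := Bool × Xh × X × Q × Uh

/-- The automaton location after the output of the observed concrete state is read. -/
noncomputable def refinedLocation (M : GMDP X U Y) (L : Y → Set AP) (A : DFA (Set AP) Q)
    (p : Memory Xh X Q Uh × X) : Q :=
  A.step (bif p.1.1 then p.1.2.2.2.1 else A.start) (L (M.out p.2))

theorem measurable_refinedLocation (M : GMDP X U Y) {L : Y → Set AP} (hL : Measurable L)
    (A : DFA (Set AP) Q) :
    Measurable (refinedLocation M L A : Memory Xh X Q Uh × X → Q) := by
  have h1 : Measurable fun p : (Bool × Q) × Set AP =>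
      A.step (bif p.1.1 then p.1.2 else A.start) p.2 := Measurable.of_discrete
  have h2 : Measurable fun p : Memory Xh X Q Uh × X => L (M.out p.2) :=
    hL.comp (M.measurable_out.comp measurable_snd)
  have h3 : Measurable fun p : Memory Xh X Q Uh × X =>
      ((p.1.1, p.1.2.2.2.1), L (M.out p.2)) :=
    Measurable.prodMk (by fun_prop) h2
  exact h1.comp h3

/-- The law of the abstract state, given the memory and the observed concrete state `x'`. Initially
it is the initial abstract state; later on it is the conditional law, given `x'`, of the abstract
component under the lifted kernel `W(dx̂' dx' | û, x̂, x)`. -/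
noncomputable def abstractStateKernel {Mh : GMDP Xh Uh Y} {M : GMDP X U Y} {ε δ : ℝ}
    (S : Simulation Mh M ε δ) : Kernel (Memory Xh X Q Uh × X) Xh :=
  haveI : Nonempty Xh := ⟨Mh.init⟩
  Kernel.piecewise (s := {p : Memory Xh X Q Uh × X | p.1.1 = false})
    (measurableSet_eq_fun (by fun_prop) measurable_const)
    (Kernel.const _ (Measure.dirac Mh.init))
    (S.W.swapRight.condKernel.comap
      (fun p : Memory Xh X Q Uh × X => ((p.1.2.2.2.2, p.1.2.1, p.1.2.2.1), p.2)) (by fun_prop))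

instance {Mh : GMDP Xh Uh Y} {M : GMDP X U Y} {ε δ : ℝ} (S : Simulation Mh M ε δ) :
    IsMarkovKernel (abstractStateKernel S : Kernel (Memory Xh X Q Uh × X) Xh) := by
  unfold abstractStateKernel; infer_instance

/-- The law of the triple of abstract state, concrete state and automaton location at the current
time, given the memory and the observed concrete state. -/
noncomputable def refinedStateKernel {Mh : GMDP Xh Uh Y} {M : GMDP X U Y} {ε δ : ℝ}
    (S : Simulation Mh M ε δ) {L : Y → Set AP} (hL : Measurable L) (A : DFA (Set AP) Q) :
    Kernel (Memory Xh X Q Uh × X) (Xh × X × Q) :=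
  abstractStateKernel S ×ₖ
    Kernel.deterministic (fun p : Memory Xh X Q Uh × X => (p.2, refinedLocation M L A p))
      (measurable_snd.prodMk (measurable_refinedLocation M hL A))

instance {Mh : GMDP Xh Uh Y} {M : GMDP X U Y} {ε δ : ℝ} (S : Simulation Mh M ε δ)
    {L : Y → Set AP} (hL : Measurable L) (A : DFA (Set AP) Q) :
    IsMarkovKernel (refinedStateKernel S hL A : Kernel (Memory Xh X Q Uh × X) (Xh × X × Q)) := by
  unfold refinedStateKernel; infer_instance

/-- The new memory state, from the current triple and abstract input. -/
def newMemory (p : Univ (Xh × X × Q) × Uh) : Memory Xh X Q Uh :=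
  (true, p.1.out.1, p.1.out.2.1, p.1.out.2.2, p.2)

theorem measurable_newMemory :
    Measurable (newMemory : Univ (Xh × X × Q) × Uh → Memory Xh X Q Uh) := by
  have h : Measurable fun p : Univ (Xh × X × Q) × Uh => (p.1.out, p.2) :=
    (Univ.measurable_out.comp measurable_fst).prodMk measurable_snd
  have h' : Measurable fun p : (Xh × X × Q) × Uh =>
    ((true, p.1.1, p.1.2.1, p.1.2.2, p.2) : Memory Xh X Q Uh) := by fun_prop
  exact h'.comp h

/-- The memory update: given the memory and the observed concrete state `x'`, draw the abstract
state `x̂'`, compute the location `q'`, draw the abstract input `û' ∼ μ(x̂', q')`, and store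
`(x̂', x', q', û')`. -/
noncomputable def refinedTrans {Mh : GMDP Xh Uh Y} {M : GMDP X U Y} {ε δ : ℝ}
    (S : Simulation Mh M ε δ) {L : Y → Set AP} (hL : Measurable L) (A : DFA (Set AP) Q)
    (μ : Policy (Xh × Q) Uh) : Kernel (Univ (Memory Xh X Q Uh × X)) (Memory Xh X Q Uh) :=
  ((extendKernel ((refinedStateKernel S hL A).comap Univ.out Univ.measurable_out)) ⊗ₖ
    (μ.kernel.comap
      (fun p : Univ (Memory Xh X Q Uh × X) × Univ (Xh × X × Q) =>
        Univ.map (fun z : Xh × X × Q => (z.1, z.2.2)) p.2)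
      ((Univ.measurable_map (by fun_prop)).comp measurable_snd))).map newMemory

/-- The strategy for the concrete gMDP that refines the stationary policy `μ` on the abstract
model through a simulation relation. It tracks the abstract state and the automaton location, lets
`μ` choose the abstract input `û`, and outputs `𝒰(û, x̂, x)` for the interface function `𝒰`. -/
noncomputable def refinedStrategy {Mh : GMDP Xh Uh Y} {M : GMDP X U Y} {ε δ : ℝ}
    (S : Simulation Mh M ε δ) {L : Y → Set AP} (hL : Measurable L) (A : DFA (Set AP) Q)
    (μ : Policy (Xh × Q) Uh) : ControlStrategy (Memory Xh X Q Uh) X U where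
  init := (false, Mh.init, M.init, A.start, (μ.toFun (Mh.init, A.start)).nonempty.some)
  trans := refinedTrans S hL A μ
  markov := Kernel.IsMarkovKernel.map _ measurable_newMemory
  out :=
    { toFun := fun c => S.interface.toFun (c.2.2.2.2, c.2.1, c.2.2.1)
      measurable := S.interface.measurable.comp
        (Univ.measurable_map (f := fun c : Memory Xh X Q Uh => (c.2.2.2.2, c.2.1, c.2.2.1))
          (by fun_prop)) }

end Refinement

/-! ### Integration of universally measurable functions -/

/-! The idea is that each use of the δ-penalty contracts the gap between the robust value and the
acceptance probability. Write V for `optValue`. For a related pair (x̂, x), let p_n(x̂, x, q) be the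
probability that the refined strategy reaches F within the next n location updates. The central
claim is V(x̂, q) ≤ p_n(x̂, x, q) + (1 - δ)^n, proved by induction on n in
`optValue_le_stateReachProb_add`.

For the induction step, let d bound the gap at stage n. Drawing x' from the concrete kernel and then
x̂' from its conditional law reproduces the coupling W (`lintegral_W`), so both sides become
integrals over W. On R, the actual label is one of the competitors in the minimum, so the worst
value is at most the acceptance probability plus d. Off R, a set of mass at most δ, the worst value
is at most 1 = d + (1 - d). The integral thus exceeds the acceptance probability by at most d + (1 -
d)δ, and the penalty -δ leaves d(1 - δ).

The argument needs only V ≤ T*(V) = T^μ(V), not that a stationary policy attains the value. With δ >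
0 the gap vanishes as n grows. With δ = 0 it would not contract, in line with the fact that a
maximizing policy may then postpone acceptance forever.

The rest links p_n to the law of the execution: `hitProb_le_traj` turns the recursion into a path
probability, and `acceptsWord_of_locationUpdate` identifies the stored location with the run of the
automaton. All integrands along the execution are only universally measurable, so kernels are
extended to the universal σ-algebra before they are iterated. -/

/-- A function is universally measurable. -/
def UMeasurable {X Y : Type*} [MeasurableSpace X] [MeasurableSpace Y] (f : X → Y) : Prop :=
  Measurable fun x : Univ X => f x.out

namespace UMeasurable

variable {X Y Z : Type*} [MeasurableSpace X] [MeasurableSpace Y] [MeasurableSpace Z]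

theorem comp_measurable {f : Y → Z} (hf : UMeasurable f) {g : X → Y} (hg : Measurable g) :
    UMeasurable fun x => f (g x) :=
  Measurable.comp (g := fun y : Univ Y => f y.out) hf (Univ.measurable_map hg)

theorem aemeasurable {f : X → ℝ≥0∞} (hf : UMeasurable f) (ν : Measure X) [IsFiniteMeasure ν] :
    AEMeasurable f ν := by
  have h : NullMeasurable f ν := fun s hs => hf hs ν
  exact h.aemeasurable

end UMeasurable

theorem Measurable.uMeasurable {X Y : Type*} [MeasurableSpace X] [MeasurableSpace Y] {f : X → Y}
    (hf : Measurable f) : UMeasurable f :=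
  hf.comp Univ.measurable_out

theorem map_out_extendMeasure {X : Type*} [MeasurableSpace X] (ν : Measure X)
    [IsFiniteMeasure ν] : (extendMeasure ν).map Univ.out = ν := by
  ext s hs
  rw [Measure.map_apply Univ.measurable_out hs,
    extendMeasure_apply ν (Univ.measurable_out hs)]
  rfl

theorem ae_extendMeasure {X : Type*} [MeasurableSpace X] (ν : Measure X) [IsFiniteMeasure ν]
    {p : X → Prop} (h : ∀ᵐ x ∂ν, p x) : ∀ᵐ x ∂(extendMeasure ν), p x.out := by
  rw [← map_out_extendMeasure ν] at h
  exact ae_of_ae_map Univ.measurable_out.aemeasurable h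

/-- A universally measurable function agrees ν-a.e. with a Borel one, and for Borel functions the
two integrals agree because `Univ.out` pushes the extension back to ν. -/
theorem lintegral_extendMeasure {X : Type*} [MeasurableSpace X] (ν : Measure X)
    [IsFiniteMeasure ν] {f : X → ℝ≥0∞} (hf : UMeasurable f) :
    ∫⁻ x, f x.out ∂(extendMeasure ν) = ∫⁻ x, f x ∂ν := by
  have h : AEMeasurable f ν := hf.aemeasurable ν
  calc ∫⁻ x, f x.out ∂(extendMeasure ν)
      = ∫⁻ x, h.mk f x.out ∂(extendMeasure ν) :=
        lintegral_congr_ae (ae_extendMeasure ν h.ae_eq_mk)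
    _ = ∫⁻ x, h.mk f x ∂((extendMeasure ν).map Univ.out) :=
        (lintegral_map h.measurable_mk Univ.measurable_out).symm
    _ = ∫⁻ x, h.mk f x ∂ν := by rw [map_out_extendMeasure]
    _ = ∫⁻ x, f x ∂ν := (lintegral_congr_ae h.ae_eq_mk).symm

theorem lintegral_extendKernel {X Y : Type*} [MeasurableSpace X] [MeasurableSpace Y]
    (κ : Kernel (Univ X) Y) [IsMarkovKernel κ] (a : Univ X) {f : Y → ℝ≥0∞} (hf : UMeasurable f) :
    ∫⁻ y, f y.out ∂(extendKernel κ a) = ∫⁻ y, f y ∂(κ a) :=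
  lintegral_extendMeasure (κ a) hf

/-- The integrand is measurable for the universal σ-algebra of the product, which is in general
larger than the product of the universal σ-algebras. Hence the kernel δ_a ⊗ κ(a) on A × B is
extended as a whole, rather than κ alone. -/
theorem UMeasurable.lintegral_kernel {A B : Type*} [MeasurableSpace A] [MeasurableSpace B]
    (κ : Kernel (Univ A) B) [IsMarkovKernel κ] {f : A × B → ℝ≥0∞} (hf : UMeasurable f) :
    UMeasurable fun a : A => ∫⁻ b, f (a, b) ∂(κ (Univ.of a)) := by
  have h : Measurable fun a : Univ A =>
      ∫⁻ p, f p.out ∂(extendKernel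
        ((Kernel.deterministic (Univ.out : Univ A → A) Univ.measurable_out) ×ₖ κ) a) :=
    Measurable.lintegral_kernel (f := fun p : Univ (A × B) => f p.out) hf
  unfold UMeasurable
  convert! h using 2 with a
  rw [lintegral_extendKernel _ _ hf, Kernel.prod_apply, Kernel.deterministic_apply,
    Measure.dirac_prod, lintegral_map' _ (by fun_prop)]
  · rfl
  · have : IsProbabilityMeasure (Measure.map (Prod.mk a.out) (κ a)) :=
      Measure.isProbabilityMeasure_map (by fun_prop)
    exact hf.aemeasurable _

/-! ### Hitting probabilities of Markov chains -/

section Hitting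

variable {Z : Type*} [MeasurableSpace Z]

/-- The Markov chain with transition kernel `κ`, in the form that is used by `Kernel.traj`. -/
noncomputable abbrev chainKernel (κ : Kernel Z Z) (n : ℕ) :
    Kernel (Π _ : Finset.Iic n, Z) Z :=
  κ.comap (fun p : (Π _ : Finset.Iic n, Z) => p ⟨n, Finset.mem_Iic.2 le_rfl⟩)
    (measurable_pi_apply _)

open Classical in
/-- The probability that a Markov chain visits `G` at one of the next `n` times. -/
noncomputable def hitProb (κ : Kernel Z Z) (G : Set Z) : ℕ → Z → ℝ≥0∞
  | 0, _ => 0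
  | n + 1, z => ∫⁻ z', (if z' ∈ G then 1 else hitProb κ G n z') ∂(κ z)

theorem measurable_hitProb (κ : Kernel Z Z) {G : Set Z} (hG : MeasurableSet G) (n : ℕ) :
    Measurable (hitProb κ G n) := by
  induction n with
  | zero => exact measurable_const
  | succ n ih =>
    exact Measurable.lintegral_kernel (Measurable.ite hG measurable_const ih)

/-- The histories up to time `n` that visit `G` after time `0`. -/
def hitSet (G : Set Z) (n : ℕ) : Set (Π _ : Finset.Iic n, Z) :=
  {h | ∃ i : Finset.Iic n, 0 < i.1 ∧ h i ∈ G}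

theorem measurableSet_hitSet {G : Set Z} (hG : MeasurableSet G) (n : ℕ) :
    MeasurableSet (hitSet G n) := by
  have : hitSet G n = ⋃ i : Finset.Iic n, {h | 0 < i.1 ∧ h i ∈ G} := by
    ext h; simp [hitSet]
  rw [this]
  exact MeasurableSet.iUnion fun i => (MeasurableSet.const _).inter (measurable_pi_apply i hG)

theorem frestrictLe_mem_hitSet_iff {G : Set Z} {n : ℕ} {ω : ℕ → Z} :
    Preorder.frestrictLe (π := fun _ => Z) n ω ∈ hitSet G n ↔
      ∃ i, 0 < i ∧ i ≤ n ∧ ω i ∈ G := by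
  simp [hitSet, Preorder.frestrictLe, and_comm]

theorem frestrictLe_succ_mem_hitSet_iff {G : Set Z} {n : ℕ} {ω : ℕ → Z} :
    Preorder.frestrictLe (π := fun _ => Z) (n + 1) ω ∈ hitSet G (n + 1) ↔
      Preorder.frestrictLe (π := fun _ => Z) n ω ∈ hitSet G n ∨ ω (n + 1) ∈ G := by
  simp only [frestrictLe_mem_hitSet_iff]
  constructor
  · rintro ⟨i, h0, hi, hG⟩
    rcases Nat.le_succ_iff.1 hi with h | h
    · exact Or.inl ⟨i, h0, h, hG⟩
    · subst h; exact Or.inr hG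
  · rintro (⟨i, h0, hi, hG⟩ | hG)
    · exact ⟨i, h0, hi.trans (Nat.le_succ n), hG⟩
    · exact ⟨n + 1, n.succ_pos, le_rfl, hG⟩

variable (κ : Kernel Z Z) [IsMarkovKernel κ]

/-- The Markov property, read off from the fact that the joint law of the history and the next state
is a composition product. -/
theorem lintegral_traj_succ (n : ℕ) (h₀ : Π _ : Finset.Iic 0, Z)
    {f : (Π _ : Finset.Iic n, Z) × Z → ℝ≥0∞} (hf : Measurable f) :
    ∫⁻ ω, f (Preorder.frestrictLe (π := fun _ => Z) n ω, ω (n + 1))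
        ∂(Kernel.traj (X := fun _ => Z) (chainKernel κ) 0 h₀) =
      ∫⁻ ω, ∫⁻ z, f (Preorder.frestrictLe (π := fun _ => Z) n ω, z) ∂(κ (ω n))
        ∂(Kernel.traj (X := fun _ => Z) (chainKernel κ) 0 h₀) := by
  have h := Kernel.partialTraj_compProd_eq_map_traj (X := fun _ => Z) (κ := chainKernel κ)
    (Nat.zero_le n) (x₀ := h₀)
  have h1 : Measurable fun ω : ℕ → Z =>
      (Preorder.frestrictLe (π := fun _ => Z) n ω, ω (n + 1)) := by fun_prop
  rw [← lintegral_map (μ := Kernel.traj (X := fun _ => Z) (chainKernel κ) 0 h₀) hf h1, ← h,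
    Measure.lintegral_compProd hf,
    ← Kernel.traj_map_frestrictLe_apply, lintegral_map _ (by fun_prop)]
  · rfl
  · exact Measurable.lintegral_kernel_prod_right' hf

theorem traj_map_frestrictLe_zero (h₀ : Π _ : Finset.Iic 0, Z) :
    (Kernel.traj (X := fun _ => Z) (chainKernel κ) 0 h₀).map
      (Preorder.frestrictLe (π := fun _ => Z) 0) = Measure.dirac h₀ := by
  rw [Kernel.traj_map_frestrictLe_apply, Kernel.partialTraj_self, Kernel.id_apply]

theorem ae_traj_zero {E : Set Z} (hE : MeasurableSet E) (h₀ : Π _ : Finset.Iic 0, Z)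
    (h : h₀ ⟨0, Finset.mem_Iic.2 le_rfl⟩ ∈ E) :
    ∀ᵐ ω ∂(Kernel.traj (X := fun _ => Z) (chainKernel κ) 0 h₀), ω 0 ∈ E := by
  have hE' : MeasurableSet {p : (Π _ : Finset.Iic 0, Z) | p ⟨0, Finset.mem_Iic.2 le_rfl⟩ ∈ E} :=
    measurable_pi_apply _ hE
  refine ae_of_ae_map (f := Preorder.frestrictLe (π := fun _ => Z) 0)
    (p := fun p => p ⟨0, Finset.mem_Iic.2 le_rfl⟩ ∈ E) (by fun_prop) ?_
  rw [traj_map_frestrictLe_zero]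
  exact (ae_dirac_iff hE').2 h

/-- The conditional probability, given the history up to n, of a visit to G by time N is a
martingale in n. Its value at n = 0 is the recursion, and at n = N it is the indicator of a visit by
time N. The starting state itself never counts as a visit. -/
theorem hitProb_le_traj {G : Set Z} (hG : MeasurableSet G) (N : ℕ)
    (h₀ : Π _ : Finset.Iic 0, Z) :
    hitProb κ G N (h₀ ⟨0, Finset.mem_Iic.2 le_rfl⟩) ≤
      Kernel.traj (X := fun _ => Z) (chainKernel κ) 0 h₀ {ω | ∃ i, ω (i + 1) ∈ G} := by
  classical
  set P := Kernel.traj (X := fun _ => Z) (chainKernel κ) 0 h₀ with hP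
  -- Here n is the elapsed time and k the remaining time; the integral of Φ depends only on n + k.
  let Φ : ℕ → ℕ → (ℕ → Z) → ℝ≥0∞ := fun n k ω =>
    if Preorder.frestrictLe (π := fun _ => Z) n ω ∈ hitSet G n then 1 else hitProb κ G k (ω n)
  have hstep (n k : ℕ) : ∫⁻ ω, Φ n (k + 1) ω ∂P = ∫⁻ ω, Φ (n + 1) k ω ∂P := by
    let f : (Π _ : Finset.Iic n, Z) × Z → ℝ≥0∞ := fun p =>
      if p.1 ∈ hitSet G n then 1 else if p.2 ∈ G then 1 else hitProb κ G k p.2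
    have hf : Measurable f :=
      Measurable.ite (measurable_fst (measurableSet_hitSet hG n)) measurable_const
        (Measurable.ite (measurable_snd hG) measurable_const
          ((measurable_hitProb κ hG k).comp measurable_snd))
    have h1 (ω : ℕ → Z) :
        Φ (n + 1) k ω = f (Preorder.frestrictLe (π := fun _ => Z) n ω, ω (n + 1)) := by
      simp only [Φ, f, frestrictLe_succ_mem_hitSet_iff]
      split_ifs <;> simp_all
    simp_rw [h1]
    rw [hP, lintegral_traj_succ κ n h₀ hf]
    refine lintegral_congr fun ω => ?_
    simp only [Φ, f]
    split_ifs with h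
    · simp
    · rfl
  have hiter (n k : ℕ) : ∫⁻ ω, Φ 0 (n + k) ω ∂P = ∫⁻ ω, Φ n k ω ∂P := by
    induction n generalizing k with
    | zero => simp
    | succ n ih => rw [← hstep, ← ih]; congr! 3; omega
  have h0 : ∫⁻ ω, Φ 0 N ω ∂P = hitProb κ G N (h₀ ⟨0, Finset.mem_Iic.2 le_rfl⟩) := by
    have h1 : P.map (Preorder.frestrictLe (π := fun _ => Z) 0) = Measure.dirac h₀ :=
      traj_map_frestrictLe_zero κ h₀
    have h2 : Measurable fun h : (Π _ : Finset.Iic 0, Z) =>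
        if h ∈ hitSet G 0 then (1 : ℝ≥0∞)
        else hitProb κ G N (h ⟨0, Finset.mem_Iic.2 le_rfl⟩) :=
      Measurable.ite (measurableSet_hitSet hG 0) measurable_const
        ((measurable_hitProb κ hG N).comp (measurable_pi_apply _))
    have h3 : h₀ ∉ hitSet G 0 := by
      rintro ⟨i, hi, -⟩
      have := Finset.mem_Iic.1 i.2
      omega
    have h4 := lintegral_map (μ := P) h2 (Preorder.measurable_frestrictLe 0)
    rw [h1, lintegral_dirac' _ h2, if_neg h3] at h4
    exact h4.symm
  -- Move all the time from remaining to elapsed: with k = 0, Φ is the indicator of a visit by time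
  -- N.
  rw [← h0, show N = N + 0 from rfl, hiter]
  have hm : MeasurableSet {ω : ℕ → Z | ∃ i, ω (i + 1) ∈ G} := by
    have : {ω : ℕ → Z | ∃ i, ω (i + 1) ∈ G} = ⋃ i, {ω | ω (i + 1) ∈ G} := by ext; simp
    rw [this]
    exact MeasurableSet.iUnion fun i => measurable_pi_apply (i + 1) hG
  rw [← lintegral_indicator_one hm]
  refine lintegral_mono fun ω => ?_
  simp only [Φ]
  split_ifs with h
  · obtain ⟨i, h0, -, hi⟩ := frestrictLe_mem_hitSet_iff.1 h
    rw [Set.indicator_of_mem]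
    · rfl
    · exact ⟨i - 1, by rwa [Nat.sub_add_cancel h0]⟩
  · simp [hitProb]

/-- For each n the indicator of a violation has integral zero by the Markov property, and there are
only countably many n. -/
theorem ae_traj_succ {E : Set (Z × Z)} (hE : MeasurableSet E)
    (h : ∀ z, ∀ᵐ z' ∂(κ z), (z, z') ∈ E) (h₀ : Π _ : Finset.Iic 0, Z) :
    ∀ᵐ ω ∂(Kernel.traj (X := fun _ => Z) (chainKernel κ) 0 h₀),
      ∀ n, (ω n, ω (n + 1)) ∈ E := by
  refine ae_all_iff.2 fun n => ?_
  let f : (Π _ : Finset.Iic n, Z) × Z → ℝ≥0∞ :=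
    Set.indicator {p | (p.1 ⟨n, Finset.mem_Iic.2 le_rfl⟩, p.2) ∈ Eᶜ} 1
  have hE' : MeasurableSet {p : (Π _ : Finset.Iic n, Z) × Z |
      (p.1 ⟨n, Finset.mem_Iic.2 le_rfl⟩, p.2) ∈ Eᶜ} :=
    (((measurable_pi_apply _).comp measurable_fst).prodMk measurable_snd) hE.compl
  have hf : Measurable f := measurable_one.indicator hE'
  have h1 := lintegral_traj_succ κ n h₀ hf
  have h2 (ω : ℕ → Z) :
      ∫⁻ z, f (Preorder.frestrictLe (π := fun _ => Z) n ω, z) ∂(κ (ω n)) = 0 := by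
    refine (lintegral_eq_zero_iff (hf.comp measurable_prodMk_left)).2 ?_
    filter_upwards [h (ω n)] with z hz
    refine Set.indicator_of_notMem ?_ _
    exact fun hz' => hz' hz
  simp only [h2, lintegral_zero] at h1
  have h3 : Measurable fun ω : ℕ → Z =>
      (Preorder.frestrictLe (π := fun _ => Z) n ω, ω (n + 1)) := by fun_prop
  replace h1 := (lintegral_eq_zero_iff (hf.comp h3)).1 h1
  filter_upwards [h1] with ω hω
  by_contra hn
  have : f (Preorder.frestrictLe (π := fun _ => Z) n ω, ω (n + 1)) = 1 :=
    Set.indicator_of_mem (a := (Preorder.frestrictLe (π := fun _ => Z) n ω, ω (n + 1))) hn _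
  simp [this] at hω

end Hitting

/-! ### One step of a controlled process -/

section Step

variable {X U Y C : Type*} [MeasurableSpace X] [StandardBorelSpace X] [MeasurableSpace U]
  [StandardBorelSpace U] [MeasurableSpace Y] [MeasurableSpace C] [StandardBorelSpace C]

theorem lintegral_mixedTrans (t : Kernel (X × U) X) (x : X) (p : ProbabilityMeasure U)
    {f : X → ℝ≥0∞} (hf : Measurable f) :
    ∫⁻ x', f x' ∂(mixedTrans t x p) = ∫⁻ u, ∫⁻ x', f x' ∂(t (x, u)) ∂(p : Measure U) :=
  Measure.lintegral_bind (t.measurable.comp measurable_prodMk_left).aemeasurable hf.aemeasurable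

theorem inputStateKernel_apply (M : GMDP X U Y) (S : ControlStrategy C X U) (x : X) (c : C) :
    inputStateKernel M S (x, Univ.of c) = mixedTrans M.trans x (S.out.toFun c) := by
  ext s hs
  rw [inputStateKernel, Kernel.snd_apply' _ _ hs, Kernel.compProd_apply (measurable_snd hs),
    mixedTrans, Measure.bind_apply (f := fun u => M.trans (x, u)) hs
      (M.trans.measurable.comp measurable_prodMk_left).aemeasurable]
  rfl

theorem UMeasurable.lintegral_inputStateKernel (M : GMDP X U Y) (S : ControlStrategy C X U)
    {f : C × X → ℝ≥0∞} (hf : UMeasurable f) {g : C → X} (hg : Measurable g) :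
    UMeasurable fun c : C => ∫⁻ x', f (c, x') ∂(inputStateKernel M S (g c, Univ.of c)) :=
  hf.lintegral_kernel ((inputStateKernel M S).comap (fun c : Univ C => (g c.out, c))
    ((hg.comp Univ.measurable_out).prodMk measurable_id))

theorem lintegral_stepKernel (M : GMDP X U Y) (S : ControlStrategy C X U) (x : X) (c : C)
    {f : X × C → ℝ≥0∞} (hf : UMeasurable f) :
    ∫⁻ z, f z ∂(stepKernel M S (Univ.of (x, c))) =
      ∫⁻ c', ∫⁻ x', f (x', c') ∂(inputStateKernel M S (x, Univ.of c'))
        ∂(S.trans (Univ.of (c, x))) := by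
  have h1 : AEMeasurable f (stepKernel M S (Univ.of (x, c))) := hf.aemeasurable _
  rw [stepKernel, Kernel.map_apply _ measurable_stepMap] at h1 ⊢
  rw [lintegral_map' h1 measurable_stepMap.aemeasurable]
  refine (Kernel.lintegral_compProd₀ _ _ _ (h1.comp_measurable measurable_stepMap)).trans ?_
  exact lintegral_extendKernel _ _
    ((hf.comp_measurable measurable_swap).lintegral_inputStateKernel M S
      (g := fun _ => x) measurable_const)

end Step

/-! ### Integrals against the kernels of the refined strategy -/

section Refinement

variable {Xh Uh X U Y AP Q : Type*} [MeasurableSpace Xh] [StandardBorelSpace Xh]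
  [MeasurableSpace Uh] [StandardBorelSpace Uh] [MeasurableSpace X] [StandardBorelSpace X]
  [MeasurableSpace U] [StandardBorelSpace U] [MetricSpace Y] [MeasurableSpace Y] [BorelSpace Y]
  [Finite AP] [Finite Q] [MeasurableSpace Q] [DiscreteMeasurableSpace Q]
  {Mh : GMDP Xh Uh Y} {M : GMDP X U Y} {ε δ : ℝ}

/-- The law of the abstract input, given the abstract state, concrete state and location. -/
noncomputable def abstractInputKernel (μ : Policy (Xh × Q) Uh) :
    Kernel (Univ (Xh × X × Q)) Uh :=
  μ.kernel.comap (Univ.map fun z : Xh × X × Q => (z.1, z.2.2))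
    (Univ.measurable_map (by fun_prop))

instance (μ : Policy (Xh × Q) Uh) :
    IsMarkovKernel (abstractInputKernel μ : Kernel (Univ (Xh × X × Q)) Uh) := by
  unfold abstractInputKernel; infer_instance

theorem lintegral_refinedTrans (S : Simulation Mh M ε δ) {L : Y → Set AP} (hL : Measurable L)
    (A : DFA (Set AP) Q) (μ : Policy (Xh × Q) Uh) (p : Memory Xh X Q Uh × X)
    {f : Memory Xh X Q Uh → ℝ≥0∞} (hf : UMeasurable f) :
    ∫⁻ c, f c ∂(refinedTrans S hL A μ (Univ.of p)) =
      ∫⁻ xh, ∫⁻ uh, f (true, xh, p.2, refinedLocation M L A p, uh)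
        ∂(μ.toFun (xh, refinedLocation M L A p) : Measure Uh) ∂(abstractStateKernel S p) := by
  have : IsMarkovKernel (refinedTrans S hL A μ) := (refinedStrategy S hL A μ).markov
  have h1 : AEMeasurable f (refinedTrans S hL A μ (Univ.of p)) := hf.aemeasurable _
  have h2 : UMeasurable fun z : Xh × X × Q =>
      ∫⁻ uh, f (true, z.1, z.2.1, z.2.2, uh) ∂(abstractInputKernel μ (Univ.of z)) :=
    UMeasurable.lintegral_kernel (abstractInputKernel μ)
      (hf.comp_measurable (g := fun z : (Xh × X × Q) × Uh =>
        ((true, z.1.1, z.1.2.1, z.1.2.2, z.2) : Memory Xh X Q Uh)) (by fun_prop))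
  rw [refinedTrans, Kernel.map_apply _ measurable_newMemory] at h1 ⊢
  rw [lintegral_map' h1 measurable_newMemory.aemeasurable]
  refine (Kernel.lintegral_compProd₀ _ _ _ (h1.comp_measurable measurable_newMemory)).trans ?_
  refine (lintegral_extendKernel ((refinedStateKernel S hL A).comap Univ.out Univ.measurable_out)
    (Univ.of p) h2).trans ?_
  have h3 : AEMeasurable (fun z : Xh × X × Q =>
      ∫⁻ uh, f (true, z.1, z.2.1, z.2.2, uh) ∂(abstractInputKernel μ (Univ.of z)))
      (refinedStateKernel S hL A p) := h2.aemeasurable _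
  change ∫⁻ z, _ ∂(refinedStateKernel S hL A p) = _
  rw [refinedStateKernel, Kernel.prod_apply, Kernel.deterministic_apply,
    Measure.prod_dirac] at h3 ⊢
  rw [lintegral_map' h3 (by fun_prop)]
  rfl

/-- Disintegration of the coupling over its concrete marginal, which on R is the law of the next
concrete state under the interface. This is why the refined strategy draws the abstract state from
the conditional law. The coordinates are swapped because `condKernel` conditions on the first one.
-/
theorem lintegral_W (S : Simulation Mh M ε δ) (xh : Xh) (x : X) (q : Q) (uh : Uh)
    (h : (xh, x) ∈ S.R) {f : Xh × X → ℝ≥0∞} (hf : UMeasurable f) :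
    ∫⁻ x', ∫⁻ xh', f (xh', x')
        ∂(abstractStateKernel S (((true, xh, x, q, uh) : Memory Xh X Q Uh), x'))
        ∂(mixedTrans M.trans x (S.interface.toFun (uh, xh, x))) =
      ∫⁻ p, f p ∂(S.W (uh, xh, x)) := by
  have : Nonempty Xh := ⟨Mh.init⟩
  have h1 : mixedTrans M.trans x (S.interface.toFun (uh, xh, x)) =
      S.W.swapRight.fst (uh, xh, x) := by
    ext s hs
    rw [← (S.lifting xh x h uh).right s hs, Kernel.fst_swapRight, Kernel.snd_apply' _ _ hs]
    congr 1
    ext; simp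
  have h2 : AEMeasurable (fun p : X × Xh => f p.swap) (S.W.swapRight (uh, xh, x)) :=
    (hf.comp_measurable measurable_swap).aemeasurable _
  have h3 : ∫⁻ p, f p ∂(S.W (uh, xh, x)) =
      ∫⁻ p : X × Xh, f p.swap ∂(S.W.swapRight (uh, xh, x)) := by
    rw [Kernel.swapRight_apply] at h2 ⊢
    rw [lintegral_map' h2 (by fun_prop)]
    rfl
  have h4 := S.W.swapRight.disintegrate S.W.swapRight.condKernel
  rw [h3, h1]
  rw [← h4] at h2
  conv_rhs => rw [← h4]
  rw [Kernel.lintegral_compProd₀ _ _ _ h2]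
  refine lintegral_congr fun x' => ?_
  have h5 : abstractStateKernel S (((true, xh, x, q, uh) : Memory Xh X Q Uh), x') =
      S.W.swapRight.condKernel ((uh, xh, x), x') := by
    rw [abstractStateKernel, Kernel.piecewise_apply, if_neg (by simp)]
    rfl
  rw [h5]
  rfl

theorem abstractStateKernel_init (S : Simulation Mh M ε δ) (p : Memory Xh X Q Uh × X)
    (hp : p.1.1 = false) : abstractStateKernel S p = Measure.dirac Mh.init := by
  have hp' : p ∈ {p : Memory Xh X Q Uh × X | p.1.1 = false} := hp
  rw [abstractStateKernel, Kernel.piecewise_apply, if_pos hp']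
  rfl

/-! ### Acceptance probabilities of the refined strategy -/

variable (S : Simulation Mh M ε δ) {L : Y → Set AP} (hL : Measurable L) (A : DFA (Set AP) Q)
  (μ : Policy (Xh × Q) Uh)

/-- The states of the controlled process whose stored location is accepting. -/
def acceptSet (X Xh Uh : Type*) {AP Q : Type*} (A : DFA (Set AP) Q) :
    Set (Univ (X × Memory Xh X Q Uh)) :=
  {z | z.out.2.2.2.2.1 ∈ A.accept}

theorem measurableSet_acceptSet : MeasurableSet (acceptSet X Xh Uh A) := by
  have h : Measurable fun z : X × Memory Xh X Q Uh => z.2.2.2.2.1 := by fun_prop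
  exact (h.comp Univ.measurable_out) (MeasurableSet.of_discrete (s := A.accept))

/-- The transition kernel of the process controlled by the refined strategy. -/
noncomputable abbrev refinedStep :
    Kernel (Univ (X × Memory Xh X Q Uh)) (Univ (X × Memory Xh X Q Uh)) :=
  extendKernel (stepKernel M (refinedStrategy S hL A μ))

/-- The probability that the process controlled by the refined strategy reaches an accepting
location within `n` steps. -/
noncomputable def reachProb (n : ℕ) (z : X × Memory Xh X Q Uh) : ℝ≥0∞ :=
  hitProb (refinedStep S hL A μ) (acceptSet X Xh Uh A) n (Univ.of z)

theorem uMeasurable_reachProb (n : ℕ) : UMeasurable (reachProb S hL A μ n) :=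
  measurable_hitProb _ (measurableSet_acceptSet A) n

/-- The same probability, after the memory update, when the input is not yet drawn. -/
noncomputable def inputReachProb (n : ℕ) (c : Memory Xh X Q Uh) : ℝ≥0∞ :=
  ∫⁻ x', reachProb S hL A μ n (x', c)
    ∂(inputStateKernel M (refinedStrategy S hL A μ) (c.2.2.1, Univ.of c))

theorem uMeasurable_inputReachProb (n : ℕ) : UMeasurable (inputReachProb S hL A μ n) :=
  ((uMeasurable_reachProb S hL A μ n).comp_measurable
    measurable_swap).lintegral_inputStateKernel M _ (g := fun c => c.2.2.1) (by fun_prop)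

/-- The same probability, when the abstract input is not yet drawn. -/
noncomputable def stateReachProb (n : ℕ) (z : Xh × X × Q) : ℝ≥0∞ :=
  ∫⁻ uh, inputReachProb S hL A μ n (true, z.1, z.2.1, z.2.2, uh)
    ∂(μ.toFun (z.1, z.2.2) : Measure Uh)

theorem uMeasurable_stateReachProb (n : ℕ) : UMeasurable (stateReachProb S hL A μ n) :=
  UMeasurable.lintegral_kernel (abstractInputKernel μ)
    ((uMeasurable_inputReachProb S hL A μ n).comp_measurable (g := fun z : (Xh × X × Q) × Uh =>
      ((true, z.1.1, z.1.2.1, z.1.2.2, z.2) : Memory Xh X Q Uh)) (by fun_prop))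

open Classical in
/-- `1` at the accepting locations, and `stateReachProb` elsewhere. -/
noncomputable def acceptOrReach (n : ℕ) (z : Xh × X × Q) : ℝ≥0∞ :=
  if z.2.2 ∈ A.accept then 1 else stateReachProb S hL A μ n z

theorem uMeasurable_acceptOrReach (n : ℕ) : UMeasurable (acceptOrReach S hL A μ n) := by
  have h : Measurable fun z : Xh × X × Q => z.2.2 := by fun_prop
  exact Measurable.ite ((h.comp Univ.measurable_out) (MeasurableSet.of_discrete (s := A.accept)))
    measurable_const (uMeasurable_stateReachProb S hL A μ n)

/-- Acceptance is tested on the new memory, whose location is determined by the old memory and the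
current x before the inputs and the next state are drawn. The test can therefore be pulled out of
the inner integrals. -/
theorem reachProb_succ (n : ℕ) (x : X) (c : Memory Xh X Q Uh) :
    reachProb S hL A μ (n + 1) (x, c) =
      ∫⁻ xh, acceptOrReach S hL A μ n (xh, x, refinedLocation M L A (c, x))
        ∂(abstractStateKernel S (c, x)) := by
  classical
  let f : X × Memory Xh X Q Uh → ℝ≥0∞ := fun z =>
    if z.2.2.2.2.1 ∈ A.accept then 1 else reachProb S hL A μ n z
  have hf : UMeasurable f :=
    Measurable.ite (measurableSet_acceptSet A) measurable_const (uMeasurable_reachProb S hL A μ n)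
  have h1 : UMeasurable fun c' : Memory Xh X Q Uh =>
      ∫⁻ x', f (x', c') ∂(inputStateKernel M (refinedStrategy S hL A μ) (x, Univ.of c')) :=
    (hf.comp_measurable measurable_swap).lintegral_inputStateKernel M _
      (g := fun _ => x) measurable_const
  have h2 : reachProb S hL A μ (n + 1) (x, c) =
      ∫⁻ z, f z ∂(stepKernel M (refinedStrategy S hL A μ) (Univ.of (x, c))) := by
    rw [← lintegral_extendKernel _ _ hf]
    rfl
  rw [h2, lintegral_stepKernel M _ x c hf]
  refine (lintegral_refinedTrans S hL A μ (c, x) h1).trans ?_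
  refine lintegral_congr fun xh => ?_
  simp only [f, acceptOrReach, stateReachProb, inputReachProb]
  split_ifs with h
  · simp
  · rfl

theorem inputReachProb_succ (n : ℕ) (xh : Xh) (x : X) (q : Q) (uh : Uh) (h : (xh, x) ∈ S.R) :
    inputReachProb S hL A μ (n + 1) (true, xh, x, q, uh) =
      ∫⁻ p, acceptOrReach S hL A μ n (p.1, p.2, A.step q (L (M.out p.2)))
        ∂(S.W (uh, xh, x)) := by
  have h1 : Measurable fun x' : X => A.step q (L (M.out x')) :=
    (Measurable.of_discrete (f := A.step q)).comp (hL.comp M.measurable_out)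
  have hf : UMeasurable fun p : Xh × X =>
      acceptOrReach S hL A μ n (p.1, p.2, A.step q (L (M.out p.2))) :=
    (uMeasurable_acceptOrReach S hL A μ n).comp_measurable
      (measurable_fst.prodMk (measurable_snd.prodMk (h1.comp measurable_snd)))
  rw [← lintegral_W S xh x q uh h hf, inputReachProb, inputStateKernel_apply]
  exact lintegral_congr fun x' => reachProb_succ S hL A μ n x' _

theorem reachProb_init (n : ℕ) (x : X) (c : Memory Xh X Q Uh) (hc : c.1 = false) :
    reachProb S hL A μ (n + 1) (x, c) =
      acceptOrReach S hL A μ n (Mh.init, x, A.step A.start (L (M.out x))) := by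
  rw [reachProb_succ, abstractStateKernel_init S (c, x) hc]
  have h : refinedLocation M L A (c, x) = A.step A.start (L (M.out x)) := by
    simp [refinedLocation, hc]
  rw [h]
  rw [lintegral_dirac]

end Refinement

/-! ### The optimal robust value is a lower bound of the acceptance probability -/

section Robust

variable {Xh Uh Y AP Q : Type*} [MeasurableSpace Xh] [StandardBorelSpace Xh]
  [MeasurableSpace Uh] [StandardBorelSpace Uh] [MetricSpace Y] [MeasurableSpace Y]
  [BorelSpace Y] [MeasurableSpace Q]

theorem optValue_le_one (Mh : GMDP Xh Uh Y) (L : Y → Set AP) (A : DFA (Set AP) Q)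
    (ε δ : ℝ) (z : Xh × Q) : optValue Mh L A ε δ z ≤ 1 := by
  refine iSup_le fun l => ?_
  cases l with
  | zero => simp
  | succ l =>
    rw [Function.iterate_succ_apply']
    exact iSup_le fun μ => min_le_left _ _

/-- Monotonicity alone gives this half of the fixed-point equation; the other half would need
continuity along the iterates. -/
theorem optValue_le_optRobustOp (Mh : GMDP Xh Uh Y) (L : Y → Set AP) (A : DFA (Set AP) Q)
    (ε δ : ℝ) : optValue Mh L A ε δ ≤ optRobustOp Mh L A ε δ (optValue Mh L A ε δ) := by
  refine fun z => iSup_le fun l => ?_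
  cases l with
  | zero => simp
  | succ l =>
    rw [Function.iterate_succ_apply']
    exact monotone_optRobustOp Mh L A ε δ
      (fun z => le_iSup (fun l => (optRobustOp Mh L A ε δ)^[l] 0 z) l) z

theorem worstValue_le (Mh : GMDP Xh Uh Y) (L : Y → Set AP) (A : DFA (Set AP) Q) {ε : ℝ}
    (V : Xh × Q → ℝ≥0∞) (q : Q) (xh : Xh) {y : Y} (hy : dist (Mh.out xh) y ≤ ε) :
    worstValue Mh L A ε V q xh ≤
      max (A.accept.indicator 1 (A.step q (L y))) (V (xh, A.step q (L y))) :=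
  iInf₂_le _ ⟨y, by rwa [dist_comm], rfl⟩

/-- Since ε ≥ 0, the abstract output itself is admissible, so the infimum is not over the empty set,
where it would be ∞. -/
theorem worstValue_le_one (Mh : GMDP Xh Uh Y) (L : Y → Set AP) (A : DFA (Set AP) Q) {ε : ℝ}
    (hε : 0 ≤ ε) {V : Xh × Q → ℝ≥0∞} (hV : ∀ z, V z ≤ 1) (q : Q) (xh : Xh) :
    worstValue Mh L A ε V q xh ≤ 1 :=
  (worstValue_le Mh L A V q xh (y := Mh.out xh) (by simpa using hε)).trans
    (max_le (Set.indicator_le_self' (fun _ _ => zero_le) _) (hV _))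

end Robust

/-- The contraction of the gap. For δ > 1 both sides are truncated to 0. -/
theorem ENNReal.add_one_sub_mul_ofReal_sub {d : ℝ≥0∞} (hd : d ≤ 1) {δ : ℝ} (hδ : 0 ≤ δ) :
    d + (1 - d) * ENNReal.ofReal δ - ENNReal.ofReal δ = d * ENNReal.ofReal (1 - δ) := by
  obtain ⟨t, rfl⟩ : ∃ t : NNReal, d = t := ⟨d.toNNReal, (ENNReal.coe_toNNReal
    (ne_top_of_le_ne_top ENNReal.one_ne_top hd)).symm⟩
  have ht : (t : ℝ) ≤ 1 := by exact_mod_cast hd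
  have h0 : (0 : ℝ) ≤ t := t.2
  rw [← ENNReal.ofReal_coe_nnreal, ← ENNReal.ofReal_one, ← ENNReal.ofReal_sub _ h0,
    ← ENNReal.ofReal_mul (by linarith), ← ENNReal.ofReal_add h0
      (mul_nonneg (by linarith) hδ), ← ENNReal.ofReal_sub _ hδ, ← ENNReal.ofReal_mul h0]
  congr 1
  ring

/-! ### Contraction of the gap along the simulation relation -/

section Refinement

variable {Xh Uh X U Y AP Q : Type*} [MeasurableSpace Xh] [StandardBorelSpace Xh]
  [MeasurableSpace Uh] [StandardBorelSpace Uh] [MeasurableSpace X] [StandardBorelSpace X]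
  [MeasurableSpace U] [StandardBorelSpace U] [MetricSpace Y] [MeasurableSpace Y] [BorelSpace Y]
  [Finite AP] [Finite Q] [MeasurableSpace Q] [DiscreteMeasurableSpace Q]
  {Mh : GMDP Xh Uh Y} {M : GMDP X U Y} {ε δ : ℝ}
  (S : Simulation Mh M ε δ) {L : Y → Set AP} (hL : Measurable L) (A : DFA (Set AP) Q)
  (μ : Policy (Xh × Q) Uh)

theorem Simulation.measure_compl_le (xh : Xh) (x : X) (h : (xh, x) ∈ S.R) (uh : Uh) :
    S.W (uh, xh, x) S.Rᶜ ≤ ENNReal.ofReal δ := by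
  rw [← ofReal_measureReal (measure_ne_top _ _)]
  refine ENNReal.ofReal_le_ofReal ?_
  rw [probReal_compl_eq_one_sub S.measurableSet_R]
  linarith [(S.lifting xh x h uh).mass]

theorem Simulation.lintegral_fst (xh : Xh) (x : X) (h : (xh, x) ∈ S.R) (uh : Uh)
    {g : Xh → ℝ≥0∞} (hg : Measurable g) :
    ∫⁻ p, g p.1 ∂(S.W (uh, xh, x)) = ∫⁻ xh', g xh' ∂(Mh.trans (xh, uh)) := by
  rw [← lintegral_map hg measurable_fst]
  congr 1
  ext s hs
  rw [Measure.map_apply measurable_fst hs, ← (S.lifting xh x h uh).left s hs, Set.prod_univ]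

/-- Related states have ε-close outputs, so the location actually reached competes in the minimum.
If it is accepting, the right side is already at least 1; otherwise the gap hypothesis applies. -/
theorem worstValue_le_acceptOrReach_add {V : Xh × Q → ℝ≥0∞} (hV : ∀ z, V z ≤ 1) {n : ℕ}
    {d : ℝ≥0∞} {xh : Xh} {x : X} (h : (xh, x) ∈ S.R)
    (hd : ∀ q, V (xh, q) ≤ stateReachProb S hL A μ n (xh, x, q) + d) (q : Q) :
    worstValue Mh L A ε V q xh ≤
      acceptOrReach S hL A μ n (xh, x, A.step q (L (M.out x))) + d := by
  refine (worstValue_le Mh L A V q xh (S.dist_le xh x h)).trans ?_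
  by_cases hF : A.step q (L (M.out x)) ∈ A.accept
  · simp [acceptOrReach, hF, hV]
  · simp [acceptOrReach, hF, hd]

/-- Both sides are integrals over the coupling, split along R and its complement. A measurable
minorant g replaces the worst value, because the passage to the abstract marginal needs
measurability. -/
theorem lintegral_W_le {V : Xh × Q → ℝ≥0∞} (hV : ∀ z, V z ≤ 1) (hε : 0 ≤ ε) {n : ℕ}
    {d : ℝ≥0∞} (hd1 : d ≤ 1)
    (hd : ∀ xh x, (xh, x) ∈ S.R → ∀ q, V (xh, q) ≤ stateReachProb S hL A μ n (xh, x, q) + d)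
    {xh : Xh} {x : X} (h : (xh, x) ∈ S.R) (q : Q) (uh : Uh) {g : Xh → ℝ≥0∞}
    (hg : Measurable g) (hgV : g ≤ worstValue Mh L A ε V q) :
    ∫⁻ xh', g xh' ∂(Mh.trans (xh, uh)) ≤
      inputReachProb S hL A μ (n + 1) (true, xh, x, q, uh) +
        (d + (1 - d) * ENNReal.ofReal δ) := by
  rw [← S.lintegral_fst xh x h uh hg, inputReachProb_succ S hL A μ n xh x q uh h]
  set φ : Xh × X → ℝ≥0∞ := fun p =>
    acceptOrReach S hL A μ n (p.1, p.2, A.step q (L (M.out p.2))) with hφ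
  have hind : Measurable fun p : Xh × X => (1 - d) * S.Rᶜ.indicator (1 : Xh × X → ℝ≥0∞) p :=
    (measurable_one.indicator S.measurableSet_R.compl).const_mul _
  calc ∫⁻ p, g p.1 ∂(S.W (uh, xh, x))
      ≤ ∫⁻ p, φ p + (d + (1 - d) * S.Rᶜ.indicator 1 p) ∂(S.W (uh, xh, x)) := by
        refine lintegral_mono fun p => (hgV p.1).trans ?_
        by_cases hp : p ∈ S.R
        · simpa [hp] using worstValue_le_acceptOrReach_add S hL A μ hV hp (hd p.1 p.2 hp) q
        -- Off R nothing relates the two sides, so only the trivial bound 1 = d + (1 - d) is used.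
        · refine (worstValue_le_one Mh L A hε hV q p.1).trans ?_
          simp [hp, add_tsub_cancel_of_le hd1]
    _ = ∫⁻ p, φ p ∂(S.W (uh, xh, x)) + (d + (1 - d) * S.W (uh, xh, x) S.Rᶜ) := by
        rw [lintegral_add_right _ (hind.const_add d), lintegral_add_right _ hind,
          lintegral_const_mul _ (measurable_one.indicator S.measurableSet_R.compl),
          lintegral_indicator_one S.measurableSet_R.compl]
        simp
    _ ≤ _ := by gcongr; exact S.measure_compl_le xh x h uh

theorem optValue_le_stateReachProb_add (hε : 0 ≤ ε) (hδ : 0 ≤ δ)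
    (hμ : IsOptimalRobustPolicy Mh L A ε δ μ) (n : ℕ) {xh : Xh} {x : X} (h : (xh, x) ∈ S.R)
    (q : Q) :
    optValue Mh L A ε δ (xh, q) ≤
      stateReachProb S hL A μ n (xh, x, q) + ENNReal.ofReal (1 - δ) ^ n := by
  induction n generalizing xh x q with
  -- At n = 0 the gap term is 1, which dominates the value.
  | zero => simpa using le_add_left (optValue_le_one Mh L A ε δ (xh, q))
  | succ n ih =>
    set V := optValue Mh L A ε δ with hV
    set d := ENNReal.ofReal (1 - δ) ^ n with hd
    have hd1 : d ≤ 1 := pow_le_one' (ENNReal.ofReal_le_one.2 (by linarith)) n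
    -- The integral is a supremum over measurable minorants, and one of them attains it; so no
    -- measurability of the value function is needed.
    obtain ⟨g, hg, hgV, hgi⟩ := exists_measurable_le_lintegral_eq
      (mixedTrans Mh.trans xh (μ.toFun (xh, q))) (worstValue Mh L A ε V q)
    have h1 : V (xh, q) ≤ robustOp Mh L A ε δ μ V (xh, q) := by
      rw [hμ]; exact optValue_le_optRobustOp Mh L A ε δ (xh, q)
    calc V (xh, q)
        ≤ ∫⁻ xh', g xh' ∂(mixedTrans Mh.trans xh (μ.toFun (xh, q))) - ENNReal.ofReal δ :=
          hgi ▸ h1.trans (min_le_right _ _)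
      _ ≤ stateReachProb S hL A μ (n + 1) (xh, x, q) + (d + (1 - d) * ENNReal.ofReal δ) -
            ENNReal.ofReal δ := by
          refine tsub_le_tsub_right ?_ _
          rw [lintegral_mixedTrans _ _ _ hg]
          refine (lintegral_mono fun uh => lintegral_W_le S hL A μ (optValue_le_one Mh L A ε δ)
            hε hd1 (fun xh x h q => ih h q) h q uh hg hgV).trans ?_
          rw [lintegral_add_right _ measurable_const]
          simp [stateReachProb]
      _ ≤ stateReachProb S hL A μ (n + 1) (xh, x, q) +
            (d + (1 - d) * ENNReal.ofReal δ - ENNReal.ofReal δ) := add_tsub_le_assoc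
      _ = _ := by rw [ENNReal.add_one_sub_mul_ofReal_sub hd1 hδ, hd, ← pow_succ]

theorem optRobustSat_le_reachProb_add (hε : 0 ≤ ε) (hδ : 0 ≤ δ)
    (hμ : IsOptimalRobustPolicy Mh L A ε δ μ) (n : ℕ) (c : Memory Xh X Q Uh)
    (hc : c.1 = false) :
    optRobustSat Mh L A ε δ ≤
      reachProb S hL A μ (n + 1) (M.init, c) + ENNReal.ofReal (1 - δ) ^ n := by
  rw [reachProb_init S hL A μ n M.init c hc]
  exact worstValue_le_acceptOrReach_add S hL A μ (optValue_le_one Mh L A ε δ) S.init_mem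
    (optValue_le_stateReachProb_add S hL A μ hε hδ hμ n S.init_mem) A.start

/-! ### The stored location is the location of the automaton -/

/-- The pairs of successive states in which the stored location has been updated correctly. -/
def locationUpdate (Xh Uh : Type*) (M : GMDP X U Y) (L : Y → Set AP) (A : DFA (Set AP) Q) :
    Set (Univ (X × Memory Xh X Q Uh) × Univ (X × Memory Xh X Q Uh)) :=
  {p | p.2.out.2.1 = true ∧
    p.2.out.2.2.2.2.1 = refinedLocation M L A (p.1.out.2, p.1.out.1)}

theorem measurableSet_locationUpdate {L : Y → Set AP} (hL : Measurable L)
    (A : DFA (Set AP) Q) :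
    MeasurableSet (locationUpdate Xh Uh M L A) := by
  have h1 : Measurable fun p : (X × Memory Xh X Q Uh) × (X × Memory Xh X Q Uh) =>
      refinedLocation M L A (p.1.2, p.1.1) :=
    (measurable_refinedLocation M hL A).comp (by fun_prop)
  have h2 : MeasurableSet {p : (X × Memory Xh X Q Uh) × (X × Memory Xh X Q Uh) |
      p.2.2.1 = true ∧ p.2.2.2.2.2.1 = refinedLocation M L A (p.1.2, p.1.1)} :=
    (measurableSet_eq_fun (by fun_prop) measurable_const).inter
      (measurableSet_eq_fun (by fun_prop) h1)
  exact ((Univ.measurable_out.comp measurable_fst).prodMk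
    (Univ.measurable_out.comp measurable_snd)) h2

/-- The flag and the location are deterministic functions of the old state, so the indicator of a
wrong update integrates to zero in the step formula. -/
theorem ae_locationUpdate (z : Univ (X × Memory Xh X Q Uh)) :
    ∀ᵐ z' ∂(refinedStep S hL A μ z), (z, z') ∈ locationUpdate Xh Uh M L A := by
  obtain ⟨x, c⟩ := z
  let B : Set (X × Memory Xh X Q Uh) :=
    {z' | z'.2.1 = true ∧ z'.2.2.2.2.1 = refinedLocation M L A (c, x)}
  have hB : MeasurableSet B :=
    (measurableSet_eq_fun (by fun_prop) measurable_const).inter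
      (measurableSet_eq_fun (by fun_prop) measurable_const)
  let f : X × Memory Xh X Q Uh → ℝ≥0∞ := Bᶜ.indicator 1
  have hf : UMeasurable f := (measurable_one.indicator hB.compl).uMeasurable
  have h1 : UMeasurable fun c' : Memory Xh X Q Uh =>
      ∫⁻ x', f (x', c') ∂(inputStateKernel M (refinedStrategy S hL A μ) (x, Univ.of c')) :=
    (hf.comp_measurable measurable_swap).lintegral_inputStateKernel M _
      (g := fun _ => x) measurable_const
  have h2 : ∫⁻ z, f z ∂(stepKernel M (refinedStrategy S hL A μ) (Univ.of (x, c))) = 0 := by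
    rw [lintegral_stepKernel M _ x c hf]
    refine (lintegral_refinedTrans S hL A μ (c, x) h1).trans ?_
    simp [f, B]
  rw [lintegral_indicator_one hB.compl] at h2
  exact ae_extendMeasure (stepKernel M (refinedStrategy S hL A μ) (Univ.of (x, c))) (p := fun z' => z' ∈ B) (ae_iff.2 h2)

theorem acceptsWord_of_locationUpdate {ω : ℕ → X × Memory Xh X Q Uh}
    (h0 : (ω 0).2.1 = false)
    (h : ∀ n, (ω (n + 1)).2.1 = true ∧
      (ω (n + 1)).2.2.2.2.1 = refinedLocation M L A ((ω n).2, (ω n).1))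
    {i : ℕ} (hi : (ω (i + 1)).2.2.2.2.1 ∈ A.accept) :
    AcceptsWord A fun t => L (M.out (ω t).1) := by
  -- The memory at time n has read the letters of times 0, …, n - 1 only. The flag supplies the
  -- initial location at n = 0, whatever is stored there.
  have key (n : ℕ) : (bif (ω n).2.1 then (ω n).2.2.2.2.1 else A.start) =
      A.eval ((List.range n).map fun t => L (M.out (ω t).1)) := by
    induction n with
    | zero => simp [h0]
    | succ n ih =>
      rw [List.range_succ, List.map_append, List.map_singleton, DFA.eval_append_singleton, ← ih,
        (h n).1, (h n).2]
      rfl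
  refine ⟨i + 1, ?_⟩
  rw [← key, (h i).1]
  exact hi

theorem reachProb_le_execLaw (n : ℕ) :
    reachProb S hL A μ n (M.init, (refinedStrategy S hL A μ).init) ≤
      execLaw M (refinedStrategy S hL A μ)
        {z | AcceptsWord A fun t => L (M.out (z t).1)} := by
  refine (hitProb_le_traj (refinedStep S hL A μ) (measurableSet_acceptSet A) n
    (fun _ => Univ.of (M.init, (refinedStrategy S hL A μ).init))).trans ?_
  have hout : Measurable fun (z : ℕ → Univ (X × Memory Xh X Q Uh)) (t : ℕ) => (z t).out :=
    measurable_pi_lambda _ fun t => Univ.measurable_out.comp (measurable_pi_apply t)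
  -- This direction of the pushforward inequality holds for every set, so the acceptance event need
  -- not be shown measurable.
  refine le_trans ?_ (Measure.le_map_apply hout.aemeasurable _)
  refine measure_mono_ae ?_
  have hflag : MeasurableSet {z : X × Memory Xh X Q Uh | z.2.1 = false} :=
    measurableSet_eq_fun (by fun_prop) measurable_const
  filter_upwards [ae_traj_succ (refinedStep S hL A μ)
      (measurableSet_locationUpdate (Xh := Xh) (Uh := Uh) (M := M) hL A)
      (ae_locationUpdate S hL A μ)
      (fun _ => Univ.of (M.init, (refinedStrategy S hL A μ).init)),
    ae_traj_zero (refinedStep S hL A μ) (Univ.measurable_out hflag)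
      (fun _ => Univ.of (M.init, (refinedStrategy S hL A μ).init)) rfl] with ω h1 h2
  rintro ⟨i, hi⟩
  exact acceptsWord_of_locationUpdate A (ω := fun t => (ω t).out) h2 h1 hi

end Refinement

/-! ### Passage to the limit -/

theorem mainTheorem6 {Xh Uh X U Y AP Q : Type*}
    [MeasurableSpace Xh] [StandardBorelSpace Xh] [MeasurableSpace Uh] [StandardBorelSpace Uh]
    [MeasurableSpace X] [StandardBorelSpace X] [MeasurableSpace U] [StandardBorelSpace U]
    [MetricSpace Y] [MeasurableSpace Y] [BorelSpace Y] [Finite AP] [Finite Q]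
    [MeasurableSpace Q] [DiscreteMeasurableSpace Q]
    (Mh : GMDP Xh Uh Y) (L : Y → Set AP) (hL : Measurable L) (ψ : ScLTL AP)
    (A : DFA (Set AP) Q) (hA : ∀ ω : ℕ → Set AP, ψ.Sat ω 0 ↔ AcceptsWord A ω)
    (ε δ : ℝ) (hε : 0 ≤ ε) (hδ : 0 < δ)
    (hτ : ∀ a : Set AP, MeasurableSet {xh : Xh | ∃ y : Y, dist y (Mh.out xh) ≤ ε ∧ L y = a})
    (μ : Policy (Xh × Q) Uh) (hμ : IsOptimalRobustPolicy Mh L A ε δ μ)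
    (M : GMDP X U Y) (S : Simulation Mh M ε δ) :
    optRobustSat Mh L A ε δ ≤
      execLaw M (refinedStrategy S hL A μ)
        {z : ℕ → X × Memory Xh X Q Uh | ψ.Sat (fun t => L (M.out (z t).1)) 0} := by
  have h1 (n : ℕ) : optRobustSat Mh L A ε δ ≤
      execLaw M (refinedStrategy S hL A μ)
        {z : ℕ → X × Memory Xh X Q Uh | AcceptsWord A fun t => L (M.out (z t).1)} +
      ENNReal.ofReal (1 - δ) ^ n :=
    (optRobustSat_le_reachProb_add S hL A μ hε hδ.le hμ n _ rfl).trans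
      (add_le_add_left (reachProb_le_execLaw S hL A μ (n + 1)) _)
  -- The only place where δ > 0, rather than δ ≥ 0, is needed.
  have h2 : Tendsto (fun n : ℕ => ENNReal.ofReal (1 - δ) ^ n) atTop (𝓝 0) :=
    ENNReal.tendsto_pow_atTop_nhds_zero_of_lt_one (ENNReal.ofReal_lt_one.2 (by linarith))
  have h3 := ge_of_tendsto' (h2.const_add _) h1
  simpa only [hA, add_zero] using h3
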